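/- **Conley-enriched stability.** Let $G$ be a finite simple graph (for instance a complete graph) on a totally ordered vertex set $V$, with edge set $E$, each edge being represented once as $(v_i,v_j)$ with $i<j$. Let $X=V\cup E$ carry the face order ($v\le e$ iff $v$ is an endpoint of $e$); for $A\subseteq X$ let $\operatorname{cl}A=\{x: x\le a \text{ for some } a\in A\}$ and $\operatorname{mo}A=\operatorname{cl}A\setminus A$. For a relation matrix $W\in\mathbb R^{V\times V}$ (not necessarily symmetric) and $\lambda\in\mathbb R$, let $\mathcal V_\lambda(W)$ be the partition of $X$ into the classes of the equivalence relation generated by $v_i\sim(v_i,v_j)$ whenever $W(i,j)>\lambda$ and $v_j\sim(v_i,v_j)$ whenever $W(j,i)>\lambda$, for edges $(v_i,v_j)\in E$. The $M$-graph of $\mathcal V_\lambda(W)$ has the blocks as nodes and an arrow $A\to B$ iff $B\cap(A\cup\operatorname{cl}A)\ne\emptyset$; the Morse sets at $\lambda$ are the unions $M\subseteq X$ of the blocks of its strongly connected components. Let the threshold $\lambda$ range over a compact interval $[a,c]$. A set $M$ that is a Morse set for some $\lambda\in[a,c]$ has birth $\lambda_b$ and death $\lambda_d$ equal to the supremum and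 the infimum of the $\lambda\in[a,c]$ at which it is a Morse set (so $\lambda_d=a$ if it survives down to $a$). Fix a field $F$ and let $\beta_k(M)=\dim_F H_k(\operatorname{cl}M,\operatorname{mo}M;F)$, the relative homology of the pair of subcomplexes of $G$. The Conley-enriched Morse persistence diagram $D_W^{(k)}$ is the multiset of labelled points $(\lambda_b,\lambda_d)$ with label $(k,\beta_k(M))$, one for each such $M$. For two labelled diagrams let $d_B$ be the infimum, over all partial matchings that only match points with equal labels, of the largest of the $\ell^\infty$-distances between matched points and of the $\ell^\infty$-distances of unmatched points to the diagonal $\{(t,t)\}$. Let $W,W'$ be relation matrices on $G$ with $\|W-W'\|_\infty=\max_{i,j}|W(i,j)-W'(i,j)|\le\varepsilon$. Then for every $k\ge 0$ $$d_B\bigl(D_W^{(k)},D_{W'}^{(k)}\bigr)\le\varepsilon ,$$ both when the diagrams of $W$ and $W'$ are taken over any common threshold range $[a,c]$, $a\le c$, and when each is taken over its own critical range, from the smallest to the largest of the values $W(i,j)$, respectively $W'(i,j)$, with $i,j$ adjacent in $G$. -/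

import Mathlib

open scoped ENNReal

noncomputable section

namespace ConleyMorse

/-! ### Multivector fields on posets, M-graphs and Morse sets -/

/-- Closure in the Alexandroff topology whose closed sets are the down-sets. -/
def cl {X : Type*} [PartialOrder X] (A : Set X) : Set X := {x | ∃ a ∈ A, x ≤ a}

/-- The mouth of `A`. -/
def mo {X : Type*} [PartialOrder X] (A : Set X) : Set X := cl A \ A

/-- A multivector field: a partition into non-empty locally closed (that is, convex) subsets. -/
structure MultivectorField (X : Type*) [PartialOrder X] where
  blocks : Set (Set X)
  isPartition : Setoid.IsPartition blocks
  locallyClosed : ∀ A ∈ blocks, A.OrdConnected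

/-- The image `Π(A) = A ∪ cl A` of a multivector `A`. -/
def image {X : Type*} [PartialOrder X] (A : Set X) : Set X := A ∪ cl A

/-- The arrows `A → B` of the M-graph, whose nodes are the multivectors. -/
def MArrow {X : Type*} [PartialOrder X] (P : MultivectorField X) (A B : Set X) : Prop :=
  A ∈ P.blocks ∧ B ∈ P.blocks ∧ (B ∩ image A).Nonempty

/-- The nodes of the strongly connected component of the multivector `A` in the M-graph. -/
def scc {X : Type*} [PartialOrder X] (P : MultivectorField X) (A : Set X) : Set (Set X) :=
  {B | B ∈ P.blocks ∧ Relation.ReflTransGen (MArrow P) A B ∧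
    Relation.ReflTransGen (MArrow P) B A}

/-- A Morse set: the union of the multivectors of a strongly connected component. -/
def IsMorseSet {X : Type*} [PartialOrder X] (P : MultivectorField X) (M : Set X) : Prop :=
  ∃ A ∈ P.blocks, M = ⋃₀ scc P A

/-! ### The poset of vertices and edges of a graph -/

/-- An edge, represented once, by its endpoints in increasing order. -/
structure Edge {V : Type*} [LinearOrder V] (G : SimpleGraph V) where
  fst : V
  snd : V
  lt : fst < snd
  adj : G.Adj fst snd

/-- The elements of `V ∪ E`. -/
inductive Cell {V : Type*} [LinearOrder V] (G : SimpleGraph V) where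
  | vertex (v : V) : Cell G
  | edge (e : Edge G) : Cell G

instance {V : Type*} [LinearOrder V] [Finite V] (G : SimpleGraph V) : Finite (Edge G) :=
  Finite.of_injective (fun e : Edge G => (e.fst, e.snd)) (by
    rintro ⟨a, b, _, _⟩ ⟨c, d, _, _⟩ h
    simp only [Prod.mk.injEq] at h
    obtain ⟨rfl, rfl⟩ := h
    rfl)

instance {V : Type*} [LinearOrder V] [Finite V] (G : SimpleGraph V) : Finite (Cell G) :=
  Finite.of_injective
    (fun c : Cell G => match c with
      | .vertex v => (Sum.inl v : V ⊕ Edge G)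
      | .edge e => Sum.inr e) (by
    rintro (a | a) (b | b) h <;> simp_all)

/-- The face order: `σ ≤ τ` iff they are equal or `σ` is an endpoint of the edge `τ`. -/
instance {V : Type*} [LinearOrder V] (G : SimpleGraph V) : PartialOrder (Cell G) where
  le σ τ := σ = τ ∨ ∃ e : Edge G, τ = .edge e ∧ (σ = .vertex e.fst ∨ σ = .vertex e.snd)
  le_refl σ := Or.inl rfl
  le_trans := by
    rintro a b c (rfl | ⟨e, rfl, h⟩) (rfl | ⟨f, rfl, h'⟩)
    · exact Or.inl rfl
    · exact Or.inr ⟨f, rfl, h'⟩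
    · exact Or.inr ⟨e, rfl, h⟩
    · simp at h'
  le_antisymm := by
    rintro a b (rfl | ⟨e, rfl, h⟩) (h' | ⟨f, rfl, h'⟩)
    · rfl
    · rfl
    · exact h'.symm
    · simp at h

/-! ### The graph multivector field of a relation matrix at a threshold -/

/-- The merges triggered by the relations that are active at threshold `t`. -/
inductive Trigger {V : Type*} [LinearOrder V] (G : SimpleGraph V) (W : V → V → ℝ) (t : ℝ) :
    Cell G → Cell G → Prop
  | fst (e : Edge G) (h : W e.fst e.snd > t) : Trigger G W t (.vertex e.fst) (.edge e)
  | snd (e : Edge G) (h : W e.snd e.fst > t) : Trigger G W t (.vertex e.snd) (.edge e)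

/-- Every set of vertices and edges is convex in the face order, which has height one. -/
theorem ordConnected_cell {V : Type*} [LinearOrder V] {G : SimpleGraph V} (A : Set (Cell G)) :
    A.OrdConnected := by
  refine ⟨fun x hx z hz y hy => ?_⟩
  obtain ⟨h1 | ⟨e, rfl, h⟩, h2 | ⟨f, rfl, h'⟩⟩ := hy
  · exact h1 ▸ hx
  · exact h1 ▸ hx
  · exact h2 ▸ hz
  · simp at h'

/-- The multivector field at threshold `t`: singletons are merged along active relations, and
transitively, so that the blocks are the classes of the generated equivalence relation. -/
def field {V : Type*} [LinearOrder V] (G : SimpleGraph V) (W : V → V → ℝ) (t : ℝ) :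
    MultivectorField (Cell G) where
  blocks := (Relation.EqvGen.setoid (Trigger G W t)).classes
  isPartition := Setoid.isPartition_classes _
  locallyClosed A _ := ordConnected_cell A

/-! ### The Conley index -/

/-- The dimension of a cell. -/
def Cell.dim {V : Type*} [LinearOrder V] {G : SimpleGraph V} : Cell G → ℕ
  | .vertex _ => 0
  | .edge _ => 1

/-- The boundary operator on chains with coefficients in `F`. -/
def boundary (F : Type*) [Field F] {V : Type*} [LinearOrder V] (G : SimpleGraph V) :
    (Cell G →₀ F) →ₗ[F] (Cell G →₀ F) :=
  Finsupp.linearCombination F fun c => match c with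
    | .vertex _ => 0
    | .edge e => Finsupp.single (.vertex e.snd) 1 - Finsupp.single (.vertex e.fst) 1

/-- The `k`-chains of `A`. -/
def chains (F : Type*) [Field F] {V : Type*} [LinearOrder V] {G : SimpleGraph V}
    (k : ℕ) (A : Set (Cell G)) : Submodule F (Cell G →₀ F) :=
  Finsupp.supported F F {c | c ∈ A ∧ c.dim = k}

/-- Relative `k`-cycles of a pair `(A, B)` of closed sets: `k`-chains of `A` with boundary in `B`. -/
def relCycles (F : Type*) [Field F] {V : Type*} [LinearOrder V] {G : SimpleGraph V}
    (k : ℕ) (A B : Set (Cell G)) : Submodule F (Cell G →₀ F) :=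
  chains F k A ⊓ (Finsupp.supported F F B).comap (boundary F G)

/-- Relative `k`-boundaries of a pair `(A, B)` of closed sets, together with the chains of `B`. -/
def relBoundaries (F : Type*) [Field F] {V : Type*} [LinearOrder V] {G : SimpleGraph V}
    (k : ℕ) (A B : Set (Cell G)) : Submodule F (Cell G →₀ F) :=
  (chains F (k + 1) A).map (boundary F G) ⊔ chains F k B

/-- The subquotient `Z / B` of a vector space, for subspaces `B ⊆ Z`. -/
abbrev Subquotient {F C : Type*} [Field F] [AddCommGroup C] [Module F C]
    (Z B : Submodule F C) : Type _ :=
  Z ⧸ B.submoduleOf Z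

/-- The relative homology `H_k(A, B; F)` of a pair `B ⊆ A` of closed sets, i.e. of subcomplexes
of the one-dimensional complex `G`. -/
abbrev RelHomology (F : Type*) [Field F] {V : Type*} [LinearOrder V] {G : SimpleGraph V}
    (k : ℕ) (A B : Set (Cell G)) : Type _ :=
  Subquotient (relCycles F k A B) (relBoundaries F k A B)

/-- The homological Conley index `CH_k(M) = H_k(cl M, mo M)`. -/
abbrev ConleyIndex (F : Type*) [Field F] {V : Type*} [LinearOrder V] {G : SimpleGraph V}
    (k : ℕ) (M : Set (Cell G)) : Type _ :=
  RelHomology F k (cl M) (mo M)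

/-- The Betti number `β_k` of the Conley index. -/
def betti (F : Type*) [Field F] {V : Type*} [LinearOrder V] {G : SimpleGraph V}
    (k : ℕ) (M : Set (Cell G)) : ℕ :=
  Module.finrank F (ConleyIndex F k M)

/-! ### The Conley-enriched Morse persistence diagram -/

/-- The thresholds in `[a, c]` at which `M` is a Morse set. -/
def aliveSet {V : Type*} [LinearOrder V] (G : SimpleGraph V) (W : V → V → ℝ) (a c : ℝ)
    (M : Set (Cell G)) : Set ℝ :=
  {t | t ∈ Set.Icc a c ∧ IsMorseSet (field G W t) M}

/-- The Morse sets that appear across the filtration over `[a, c]`. -/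
def morseSets {V : Type*} [LinearOrder V] (G : SimpleGraph V) (W : V → V → ℝ) (a c : ℝ) :
    Set (Set (Cell G)) :=
  {M | (aliveSet G W a c M).Nonempty}

/-- Thresholds are scanned downwards: `M` is born at the top of its set of thresholds. -/
def birth {V : Type*} [LinearOrder V] (G : SimpleGraph V) (W : V → V → ℝ) (a c : ℝ)
    (M : Set (Cell G)) : ℝ :=
  sSup (aliveSet G W a c M)

/-- `M` dies at the bottom of its set of thresholds; this is `a` if it survives down to `a`. -/
def death {V : Type*} [LinearOrder V] (G : SimpleGraph V) (W : V → V → ℝ) (a c : ℝ)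
    (M : Set (Cell G)) : ℝ :=
  sInf (aliveSet G W a c M)

/-- A point `(λ_b, λ_d)` with its label `(k, β_k)`. -/
abbrev LabelledPoint : Type := (ℝ × ℝ) × (ℕ × ℕ)

/-- The Conley-enriched Morse persistence diagram in degree `k`, over the threshold range
`[a, c]`: one labelled point for each Morse set that appears. -/
def diagram (F : Type*) [Field F] {V : Type*} [LinearOrder V] [Finite V] (G : SimpleGraph V)
    (W : V → V → ℝ) (a c : ℝ) (k : ℕ) : Multiset LabelledPoint :=
  (Set.toFinite (morseSets G W a c)).toFinset.val.map fun M =>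
    ((birth G W a c M, death G W a c M), (k, betti F k M))

/-- The critical thresholds. -/
def criticalValues {V : Type*} (G : SimpleGraph V) (W : V → V → ℝ) : Set ℝ :=
  {t | ∃ i j, G.Adj i j ∧ W i j = t}

/-- The diagram over the range `[min Λ, max Λ]` of the set `Λ` of critical thresholds. -/
def criticalDiagram (F : Type*) [Field F] {V : Type*} [LinearOrder V] [Finite V]
    (G : SimpleGraph V) (W : V → V → ℝ) (k : ℕ) : Multiset LabelledPoint :=
  diagram F G W (sInf (criticalValues G W)) (sSup (criticalValues G W)) k

/-! ### The bottleneck distance of labelled diagrams -/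

/-- Sup-norm distance of two points with the same label; `∞` if the labels differ. -/
def pointCost (p q : LabelledPoint) : ℝ≥0∞ := ⨅ _ : p.2 = q.2, edist p.1 q.1

/-- Sup-norm distance of a point to the diagonal. -/
def diagonalCost (p : LabelledPoint) : ℝ≥0∞ := ⨅ t : ℝ, edist p.1 (t, t)

/-- The bottleneck distance: the infimum over all matchings of the largest cost. A matching
consists of a multiset `m` of matched pairs, the remaining points `r₁` and `r₂` of the two
diagrams being matched to the diagonal. -/
def bottleneckDist (D₁ D₂ : Multiset LabelledPoint) : ℝ≥0∞ :=
  ⨅ (m : Multiset (LabelledPoint × LabelledPoint)) (r₁ : Multiset LabelledPoint)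
    (r₂ : Multiset LabelledPoint) (_ : D₁ = m.map Prod.fst + r₁) (_ : D₂ = m.map Prod.snd + r₂),
    (⨆ x ∈ m, pointCost x.1 x.2) ⊔ (⨆ p ∈ r₁, diagonalCost p) ⊔ (⨆ p ∈ r₂, diagonalCost p)

end ConleyMorse

end

/-! A Morse set is a strongly connected component of a digraph on cells. By `isMorseSet_iff` this
splits into two conditions of opposite monotonicity: `Joined` survives when more relations become
active, `Saturated` when fewer do. Hence the thresholds at which a fixed `M` is a Morse set form an
interval. The relations of `W` active at `s + ε` are active for `W'` at `s`, and those of `W'` at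
`s` are active for `W` at `s - ε`. So joinedness passes from `W` to `W'` after lowering the
threshold by `ε`, and saturation after raising it by `ε`. Match each `M` with itself; the label
depends on `M` alone. If `M` appears for both matrices, its birth and death each move by at most
`ε`. If it appears for only one, its interval has length at most `2ε`, so its point is within `ε` of
the diagonal. -/

namespace ConleyMorse

open Relation

/-! ### Morse sets as strong components of a digraph on cells -/

section MorseSets

variable {V : Type*} [LinearOrder V] {G : SimpleGraph V} {W W' : V → V → ℝ}

/-- The steps of the cell digraph, whose strongly connected components are the Morse sets: from a
cell to its faces, and from a vertex along an active relation. -/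
def Step (G : SimpleGraph V) (W : V → V → ℝ) (t : ℝ) (x y : Cell G) : Prop :=
  Trigger G W t x y ∨ y ≤ x

/-- Reachability in the cell digraph. -/
def Reach (G : SimpleGraph V) (W : V → V → ℝ) (t : ℝ) : Cell G → Cell G → Prop :=
  ReflTransGen (Step G W t)

theorem Trigger.le {t : ℝ} {x y : Cell G} (h : Trigger G W t x y) : x ≤ y := by
  cases h with
  | fst e _ => exact Or.inr ⟨e, rfl, Or.inl rfl⟩
  | snd e _ => exact Or.inr ⟨e, rfl, Or.inr rfl⟩

theorem Trigger.mono {s t : ℝ} (h : ∀ i j, W i j > t → W' i j > s) {x y : Cell G}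
    (hxy : Trigger G W t x y) : Trigger G W' s x y := by
  cases hxy with
  | fst e he => exact .fst e (h _ _ he)
  | snd e he => exact .snd e (h _ _ he)

theorem Reach.mono {s t : ℝ} (h : ∀ i j, W i j > t → W' i j > s) {x y : Cell G}
    (hxy : Reach G W t x y) : Reach G W' s x y :=
  ReflTransGen.mono (fun _ _ => Or.imp_left (Trigger.mono h)) _ _ hxy

/-- A trigger can be traversed both ways: forwards as an active relation, backwards as a step from
an edge to its face. -/
theorem reach_of_eqvGen {t : ℝ} {x y : Cell G} (h : EqvGen (Trigger G W t) x y) :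
    Reach G W t x y ∧ Reach G W t y x := by
  induction h with
  | rel x y h => exact ⟨.single (Or.inl h), .single (Or.inr h.le)⟩
  | refl x => exact ⟨.refl, .refl⟩
  | symm x y _ ih => exact ih.symm
  | trans x y z _ _ h₁ h₂ => exact ⟨h₁.1.trans h₂.1, h₂.2.trans h₁.2⟩

/-- The multivector of a cell. -/
def blockOf (G : SimpleGraph V) (W : V → V → ℝ) (t : ℝ) (x : Cell G) : Set (Cell G) :=
  {y | EqvGen (Trigger G W t) y x}

theorem mem_blockOf_self (t : ℝ) (x : Cell G) : x ∈ blockOf G W t x := EqvGen.refl x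

/-- Cells of one block reach each other, so a path of blocks lifts to a path of cells between any
chosen representatives. -/
theorem reach_of_reflTransGen_mArrow {t : ℝ} {A B : Set (Cell G)}
    (hA : A ∈ (field G W t).blocks) (h : ReflTransGen (MArrow (field G W t)) A B) :
    ∀ x ∈ A, ∀ y ∈ B, Reach G W t x y := by
  have key : ∀ {C : Set (Cell G)}, C ∈ (field G W t).blocks → ∀ x ∈ C, ∀ y ∈ C,
      Reach G W t x y := by
    rintro C ⟨z, rfl⟩ x hx y hy
    exact (reach_of_eqvGen (EqvGen.trans _ _ _ hx (EqvGen.symm _ _ hy))).1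
  induction h with
  | refl => exact key hA
  | tail _ h ih =>
    obtain ⟨-, hC, z, hzC, hz⟩ := h
    intro x hx y hy
    refine ReflTransGen.trans ?_ (key hC z hzC y hy)
    rcases hz with hz | ⟨a, ha, hza⟩
    · exact ih x hx z hz
    · exact (ih x hx a ha).tail (Or.inr hza)

theorem Reach.reflTransGen_mArrow {t : ℝ} {x y : Cell G} (h : Reach G W t x y) :
    ReflTransGen (MArrow (field G W t)) (blockOf G W t x) (blockOf G W t y) := by
  refine ReflTransGen.lift (blockOf G W t) (fun a b hab => ⟨⟨a, rfl⟩, ⟨b, rfl⟩, ?_⟩) _ _ h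
  refine ⟨b, mem_blockOf_self t b, ?_⟩
  rcases hab with hab | hab
  · exact Or.inl (EqvGen.symm _ _ (EqvGen.rel _ _ hab))
  · exact Or.inr ⟨a, mem_blockOf_self t a, hab⟩

theorem sUnion_scc_blockOf (t : ℝ) (x : Cell G) :
    ⋃₀ scc (field G W t) (blockOf G W t x) = {y | Reach G W t x y ∧ Reach G W t y x} := by
  ext y
  constructor
  · rintro ⟨B, ⟨hB, h₁, h₂⟩, hy⟩
    exact ⟨reach_of_reflTransGen_mArrow ⟨x, rfl⟩ h₁ x (mem_blockOf_self t x) y hy,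
      reach_of_reflTransGen_mArrow hB h₂ y hy x (mem_blockOf_self t x)⟩
  · rintro ⟨h₁, h₂⟩
    exact ⟨blockOf G W t y, ⟨⟨y, rfl⟩, h₁.reflTransGen_mArrow, h₂.reflTransGen_mArrow⟩,
      mem_blockOf_self t y⟩

/-- The cells of `M` are mutually reachable. -/
def Joined (G : SimpleGraph V) (W : V → V → ℝ) (t : ℝ) (M : Set (Cell G)) : Prop :=
  ∀ x ∈ M, ∀ y ∈ M, Reach G W t x y

/-- No cell outside `M` is mutually reachable with a cell of `M`. -/
def Saturated (G : SimpleGraph V) (W : V → V → ℝ) (t : ℝ) (M : Set (Cell G)) : Prop :=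
  ∀ x ∈ M, ∀ y, Reach G W t x y → Reach G W t y x → y ∈ M

/-- Separates the part of strong connectedness that is monotone in the active relations from the
part that is antitone, so that each can be carried over from a different threshold or matrix. -/
theorem isMorseSet_iff {t : ℝ} {M : Set (Cell G)} :
    IsMorseSet (field G W t) M ↔ M.Nonempty ∧ Joined G W t M ∧ Saturated G W t M := by
  constructor
  · rintro ⟨_, ⟨x, rfl⟩, rfl⟩
    change (⋃₀ scc (field G W t) (blockOf G W t x)).Nonempty ∧
      Joined G W t (⋃₀ scc (field G W t) (blockOf G W t x)) ∧
      Saturated G W t (⋃₀ scc (field G W t) (blockOf G W t x))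
    rw [sUnion_scc_blockOf]
    exact ⟨⟨x, .refl, .refl⟩, fun y hy z hz => hy.2.trans hz.1,
      fun y hy z h₁ h₂ => ⟨hy.1.trans h₁, h₂.trans hy.2⟩⟩
  · rintro ⟨⟨x, hx⟩, hJ, hS⟩
    refine ⟨blockOf G W t x, ⟨x, rfl⟩, ?_⟩
    rw [sUnion_scc_blockOf]
    ext y
    exact ⟨fun hy => ⟨hJ x hx y hy, hJ y hy x hx⟩, fun hy => hS x hx y hy.1 hy.2⟩

theorem Joined.mono {s t : ℝ} (h : ∀ i j, W i j > t → W' i j > s) {M : Set (Cell G)}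
    (hM : Joined G W t M) : Joined G W' s M :=
  fun x hx y hy => (hM x hx y hy).mono h

theorem Saturated.mono {s t : ℝ} (h : ∀ i j, W' i j > s → W i j > t) {M : Set (Cell G)}
    (hM : Saturated G W t M) : Saturated G W' s M :=
  fun x hx y h₁ h₂ => hM x hx y (h₁.mono h) (h₂.mono h)

end MorseSets

/-! ### Births and deaths under perturbation -/

section Stability

variable {V : Type*} [LinearOrder V] {G : SimpleGraph V} {W W' : V → V → ℝ}
  {a c a' c' ε : ℝ} {M : Set (Cell G)}

/-- If `M` is a Morse set of `W` at `t₁` and at `t₂`, it is one of any `ε`-close `W'` at each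
threshold between `t₂ + ε` and `t₁ - ε`. -/
theorem isMorseSet_of_close (hW : ∀ i j, |W i j - W' i j| ≤ ε) {t₁ t₂ s : ℝ}
    (h₁ : IsMorseSet (field G W t₁) M) (h₂ : IsMorseSet (field G W t₂) M)
    (hs₁ : s ≤ t₁ - ε) (hs₂ : t₂ + ε ≤ s) : IsMorseSet (field G W' s) M := by
  rw [isMorseSet_iff] at *
  refine ⟨h₁.1, h₁.2.1.mono fun i j h => ?_, h₂.2.2.mono fun i j h => ?_⟩ <;>
  · have := abs_le.1 (hW i j)
    linarith

theorem bddAbove_aliveSet : BddAbove (aliveSet G W a c M) := ⟨c, fun _ ht => ht.1.2⟩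

theorem bddBelow_aliveSet : BddBelow (aliveSet G W a c M) := ⟨a, fun _ ht => ht.1.1⟩

theorem birth_le_birth_add (hW : ∀ i j, |W i j - W' i j| ≤ ε) (hc : c ≤ c' + ε)
    (h : (aliveSet G W a c M).Nonempty) (h' : (aliveSet G W' a' c' M).Nonempty) :
    birth G W a c M ≤ birth G W' a' c' M + ε := by
  refine csSup_le h fun t ht => ?_
  obtain ⟨s, hs⟩ := h'
  have hsb : s ≤ birth G W' a' c' M := le_csSup bddAbove_aliveSet hs
  rcases le_or_gt (t - ε) s with hst | hst
  · linarith
  -- Joinedness comes from `W` at `t`, saturation from `W'` at the lower threshold `s`. As `a' ≤ s`,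
  -- only the upper ends of the ranges need comparing.
  have hmem : t - ε ∈ aliveSet G W' a' c' M := by
    refine ⟨⟨hs.1.1.trans hst.le, by linarith [ht.1.2]⟩, ?_⟩
    have h₁ := isMorseSet_iff.1 ht.2
    have h₂ := isMorseSet_iff.1 hs.2
    refine isMorseSet_iff.2 ⟨h₁.1, h₁.2.1.mono fun i j h => ?_, h₂.2.2.mono fun i j h => ?_⟩
    · have := abs_le.1 (hW i j)
      linarith
    · linarith
  have : t - ε ≤ birth G W' a' c' M := le_csSup bddAbove_aliveSet hmem
  linarith

theorem death_le_death_add (hW : ∀ i j, |W i j - W' i j| ≤ ε) (ha : a' ≤ a + ε)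
    (h : (aliveSet G W a c M).Nonempty) (h' : (aliveSet G W' a' c' M).Nonempty) :
    death G W' a' c' M ≤ death G W a c M + ε := by
  rw [← sub_le_iff_le_add]
  refine le_csInf h fun t ht => ?_
  obtain ⟨s, hs⟩ := h'
  have hsb : death G W' a' c' M ≤ s := csInf_le bddBelow_aliveSet hs
  rcases le_or_gt s (t + ε) with hst | hst
  · linarith
  -- Dually, joinedness comes from `W'` at the higher threshold `s`, saturation from `W` at `t`.
  have hmem : t + ε ∈ aliveSet G W' a' c' M := by
    refine ⟨⟨by linarith [ht.1.1], hst.le.trans hs.1.2⟩, ?_⟩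
    have h₁ := isMorseSet_iff.1 ht.2
    have h₂ := isMorseSet_iff.1 hs.2
    refine isMorseSet_iff.2 ⟨h₁.1, h₂.2.1.mono fun i j h => ?_, h₁.2.2.mono fun i j h => ?_⟩
    · linarith
    · have := abs_le.1 (hW i j)
      linarith
  have : death G W' a' c' M ≤ t + ε := csInf_le bddBelow_aliveSet hmem
  linarith

theorem death_le_birth (h : (aliveSet G W a c M).Nonempty) :
    death G W a c M ≤ birth G W a c M :=
  csInf_le_csSup h bddBelow_aliveSet bddAbove_aliveSet

theorem birth_le_death_add (hW : ∀ i j, |W i j - W' i j| ≤ ε) (ha : a' ≤ a + ε)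
    (hc : c ≤ c' + ε) (h : (aliveSet G W a c M).Nonempty)
    (h' : ¬(aliveSet G W' a' c' M).Nonempty) :
    birth G W a c M ≤ death G W a c M + 2 * ε := by
  refine csSup_le h fun t₁ ht₁ => ?_
  rw [← sub_le_iff_le_add]
  refine le_csInf h fun t₂ ht₂ => ?_
  by_contra! hlt
  -- If `t₁ - t₂ > 2ε`, then `t₁ - ε` lies above `t₂ + ε`, hence above `a'`, and `M` would be a
  -- Morse set of `W'` there.
  refine h' ⟨t₁ - ε, ⟨by linarith [ht₂.1.1], by linarith [ht₁.1.2]⟩, ?_⟩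
  exact isMorseSet_of_close hW ht₁.2 ht₂.2 le_rfl (by linarith)

end Stability

/-! ### Matchings and the bottleneck distance -/

theorem pointCost_le {p q : LabelledPoint} {ε : ℝ} (hl : p.2 = q.2)
    (h₁ : |p.1.1 - q.1.1| ≤ ε) (h₂ : |p.1.2 - q.1.2| ≤ ε) :
    pointCost p q ≤ ENNReal.ofReal ε := by
  refine iInf_le_of_le hl ?_
  rw [edist_dist]
  exact ENNReal.ofReal_le_ofReal (max_le h₁ h₂)

theorem diagonalCost_le {p : LabelledPoint} {ε : ℝ} (h : |p.1.1 - p.1.2| ≤ 2 * ε) :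
    diagonalCost p ≤ ENNReal.ofReal ε := by
  rw [abs_le] at h
  -- The midpoint of the two coordinates is the nearest diagonal parameter.
  refine iInf_le_of_le ((p.1.1 + p.1.2) / 2) ?_
  rw [edist_dist]
  refine ENNReal.ofReal_le_ofReal (max_le ?_ ?_) <;> rw [Real.dist_eq, abs_le] <;>
    constructor <;> dsimp only <;> linarith

/-- Two diagrams indexed by finite sets are compared by matching equal indices. -/
theorem bottleneckDist_map_le {ι : Type*} (S T : Finset ι) (f g : ι → LabelledPoint) (r : ℝ≥0∞)
    (hfg : ∀ i ∈ S, i ∈ T → pointCost (f i) (g i) ≤ r)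
    (hf : ∀ i ∈ S, i ∉ T → diagonalCost (f i) ≤ r)
    (hg : ∀ i ∈ T, i ∉ S → diagonalCost (g i) ≤ r) :
    bottleneckDist (S.val.map f) (T.val.map g) ≤ r := by
  classical
  have split : ∀ A B : Finset ι, A.val = (A ∩ B).val + (A \ B).val := fun A B => by
    rw [← Finset.disjUnion_val _ _ (Finset.disjoint_sdiff_inter A B).symm,
      Finset.disjUnion_eq_union, Finset.inter_comm, Finset.union_comm, Finset.inter_comm,
      Finset.sdiff_union_inter]
  refine iInf_le_of_le ((S ∩ T).val.map fun i => (f i, g i)) <|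
    iInf_le_of_le ((S \ T).val.map f) <| iInf_le_of_le ((T \ S).val.map g) <|
    iInf_le_of_le ?_ <| iInf_le_of_le ?_ ?_
  · rw [Multiset.map_map]
    conv_lhs => rw [split S T, Multiset.map_add]
    rfl
  · rw [Multiset.map_map]
    conv_lhs => rw [split T S, Multiset.map_add, Finset.inter_comm]
    rfl
  · refine sup_le (sup_le ?_ ?_) ?_ <;> refine iSup₂_le fun x hx => ?_ <;>
      obtain ⟨i, hi, rfl⟩ := Multiset.mem_map.1 hx <;> rw [Finset.mem_val] at hi
    · exact hfg i (Finset.mem_inter.1 hi).1 (Finset.mem_inter.1 hi).2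
    · exact hf i (Finset.mem_sdiff.1 hi).1 (Finset.mem_sdiff.1 hi).2
    · exact hg i (Finset.mem_sdiff.1 hi).1 (Finset.mem_sdiff.1 hi).2

theorem bottleneckDist_diagram_le {F : Type*} [Field F] {V : Type*} [LinearOrder V] [Finite V]
    (G : SimpleGraph V) {W W' : V → V → ℝ} {a c a' c' ε : ℝ}
    (hW : ∀ i j, |W i j - W' i j| ≤ ε) (ha : |a - a'| ≤ ε) (hc : |c - c'| ≤ ε) (k : ℕ) :
    bottleneckDist (diagram F G W a c k) (diagram F G W' a' c' k) ≤ ENNReal.ofReal ε := by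
  have hW' : ∀ i j, |W' i j - W i j| ≤ ε := fun i j => abs_sub_comm (W i j) _ ▸ hW i j
  rw [abs_le] at ha hc
  refine bottleneckDist_map_le _ _ _ _ _ (fun M h h' => ?_) (fun M h h' => ?_)
    (fun M h h' => ?_) <;> rw [Set.Finite.mem_toFinset] at h h'
  -- Both labels are `(k, betti F k M)`, whatever the matrix.
  · refine pointCost_le rfl (abs_le.2 ⟨?_, ?_⟩) (abs_le.2 ⟨?_, ?_⟩) <;> dsimp only
    · linarith [birth_le_birth_add (c' := c) hW' (by linarith) h' h]
    · linarith [birth_le_birth_add (c' := c') hW (by linarith) h h']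
    · linarith [death_le_death_add (a' := a') hW (by linarith) h h']
    · linarith [death_le_death_add (a' := a) hW' (by linarith) h' h]
  · refine diagonalCost_le (abs_le.2 ⟨?_, ?_⟩) <;> dsimp only
    · linarith [death_le_birth h]
    · linarith [birth_le_death_add hW (by linarith) (by linarith) h h']
  · refine diagonalCost_le (abs_le.2 ⟨?_, ?_⟩) <;> dsimp only
    · linarith [death_le_birth h]
    · linarith [birth_le_death_add hW' (by linarith) (by linarith) h h']

/-! ### Stability of the critical range -/

section CriticalValues

variable {V : Type*} [Finite V] (G : SimpleGraph V) {W W' : V → V → ℝ} {ε : ℝ}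

theorem finite_criticalValues (W : V → V → ℝ) : (criticalValues G W).Finite :=
  (Set.finite_range fun p : V × V => W p.1 p.2).subset <| by
    rintro _ ⟨i, j, -, rfl⟩
    exact ⟨(i, j), rfl⟩

theorem sInf_criticalValues_le (hW : ∀ i j, |W i j - W' i j| ≤ ε)
    (h : (criticalValues G W').Nonempty) :
    sInf (criticalValues G W) ≤ sInf (criticalValues G W') + ε := by
  rw [← sub_le_iff_le_add]
  refine le_csInf h ?_
  rintro _ ⟨i, j, hij, rfl⟩
  linarith [(abs_le.1 (hW i j)).2,
    csInf_le (finite_criticalValues G W).bddBelow ⟨i, j, hij, rfl⟩]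

theorem sSup_criticalValues_le (hW : ∀ i j, |W i j - W' i j| ≤ ε)
    (h : (criticalValues G W).Nonempty) :
    sSup (criticalValues G W) ≤ sSup (criticalValues G W') + ε := by
  refine csSup_le h ?_
  rintro _ ⟨i, j, hij, rfl⟩
  linarith [(abs_le.1 (hW i j)).2,
    le_csSup (finite_criticalValues G W').bddAbove ⟨i, j, hij, rfl⟩]

theorem abs_sub_criticalValues_le (hε : 0 ≤ ε) (hW : ∀ i j, |W i j - W' i j| ≤ ε) :
    |sInf (criticalValues G W) - sInf (criticalValues G W')| ≤ ε ∧
      |sSup (criticalValues G W) - sSup (criticalValues G W')| ≤ ε := by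
  have hW' : ∀ i j, |W' i j - W i j| ≤ ε := fun i j => abs_sub_comm (W i j) _ ▸ hW i j
  by_cases h : ∃ i j, G.Adj i j
  · obtain ⟨i, j, hij⟩ := h
    have hne : ∀ U : V → V → ℝ, (criticalValues G U).Nonempty := fun U => ⟨_, i, j, hij, rfl⟩
    constructor <;> rw [abs_le] <;> constructor
    · linarith [sInf_criticalValues_le G hW' (hne W)]
    · linarith [sInf_criticalValues_le G hW (hne W')]
    · linarith [sSup_criticalValues_le G hW' (hne W')]
    · linarith [sSup_criticalValues_le G hW (hne W)]
  -- Without edges both ranges are `[0, 0]`, since `sInf ∅ = sSup ∅ = 0` in `ℝ`.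
  · have hempty : ∀ U : V → V → ℝ, criticalValues G U = ∅ := fun U =>
      Set.eq_empty_of_forall_notMem fun _ ⟨i, j, hij, _⟩ => h ⟨i, j, hij⟩
    simp [hempty, hε]

end CriticalValues

end ConleyMorse

/-- `‖W - W'‖` is the sup norm on the entries. The threshold range of the filtration is either any
fixed compact interval, or the range of the critical thresholds of the respective matrix. -/
theorem mainTheorem2 {F : Type*} [Field F] {V : Type*} [Fintype V] [LinearOrder V]
    (G : SimpleGraph V) (W W' : V → V → ℝ) (ε : ℝ) (hW : ‖W - W'‖ ≤ ε) (k : ℕ) :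
    (∀ a c : ℝ, a ≤ c →
      ConleyMorse.bottleneckDist (ConleyMorse.diagram F G W a c k)
        (ConleyMorse.diagram F G W' a c k) ≤ ENNReal.ofReal ε) ∧
    ConleyMorse.bottleneckDist (ConleyMorse.criticalDiagram F G W k)
      (ConleyMorse.criticalDiagram F G W' k) ≤ ENNReal.ofReal ε := by
  have hε : 0 ≤ ε := (norm_nonneg _).trans hW
  have hW' : ∀ i j, |W i j - W' i j| ≤ ε := fun i j =>
    ((norm_le_pi_norm ((W - W') i) j).trans (norm_le_pi_norm (W - W') i)).trans hW
  have hcrit := ConleyMorse.abs_sub_criticalValues_le G hε hW'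
  exact ⟨fun a c _ => ConleyMorse.bottleneckDist_diagram_le G hW' (by simpa) (by simpa) k,
    ConleyMorse.bottleneckDist_diagram_le G hW' hcrit.1 hcrit.2 k⟩
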